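/- Let $d\in\mathbb N$, $\bar r>12$ an integer, $T\in C^\infty(\mathbb T^d,\mathbb T^d)$, $\alpha\in C^\infty(\mathbb T^d,\mathbb R)$, $\beta\in C^\infty(\mathbb T^d,\mathbb R^d)$, where $\mathbb T^d=\mathbb R^d/\mathbb Z^d$. Let $\mathcal D=C^{\bar r}(\mathbb T^d,\mathbb R)'$ be the dual Banach space; write $\int h\varphi:=h(\varphi)$, identify a function $\varphi$ with the distribution $g\mapsto\int_{\mathbb T^d}\varphi g\,dx$, and write $h\ge 0$ if $h(\varphi)\ge0$ for all $0\le\varphi\in C^{\bar r}$. For $\nu\in\mathbb R$ and $h\in\mathcal D$ let $$T_{\nu,h}(x)=T(x)+\nu\,\beta(x)\,h(\alpha)\ \bmod 1,\qquad (\mathcal L_S h)(g)=h(g\circ S)\ \ (S\in C^{\bar r}(\mathbb T^d,\mathbb T^d)),\qquad \widetilde{\mathcal L}_\nu(h)=\mathcal L_{T_{\nu,h}}h .$$ Let $\mathcal T\subset C^{\bar r}(\mathbb T^d,\mathbb T^d)$ be a set of surjective maps closed under composition, and let $\nu_*>0$ be such that $T_{\nu,h}\in\mathcal T$ for all $\nu\in[0,\nu_*]$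 and all Borel probability measures $h$ on $\mathbb T^d$. Let $\mathcal B_0,\dots,\mathcal B_3$ be real Banach spaces with continuous embeddings $\mathcal D\supset\mathcal B_0\supset\mathcal B_1\supset\mathcal B_2\supset\mathcal B_3\supset C^{\bar r}(\mathbb T^d,\mathbb R)$, $\|\cdot\|_{\mathcal B_i}\le\|\cdot\|_{\mathcal B_{i+1}}$, such that $C^{\bar r}(\mathbb T^d,\mathbb R)$ is dense in each $\mathcal B_i$ and in each dual $\mathcal B_i'$. Assume that there are $K,C_*\ge1$, $\vartheta\in(0,1)$, integers $\bar c,\hat c>0$ and an integer $\bar n\ge1$ such that: * (A1) $\mathcal L_S\in L(\mathcal B_i,\mathcal B_i)$ for all $S\in\mathcal T$, $0\le i\le3$. * (A2) $\partial_{x_k}\in L(\mathcal B_{i+1},\mathcal B_i)$ for $1\le k\le d$, $0\le i\le2$ (distributional derivative). * (A3) $\|ah\|_{\mathcal B_i}\le C_*\|a\|_{C^{\bar c i+\hat c}}\|h\|_{\mathcal B_i}$ for all $a\in C^\infty(\mathbb T^d,\mathbb R)$, $h\in\mathcal B_i$, $0\le i\le3$, and $|\int h|\le C_*\|h\|_{\mathcal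 B_0}$ for all $h\in\mathcal B_0$. * (A4) The unit ball of $\mathcal B_{i+1}$ is relatively compact in $\mathcal B_i$, $0\le i\le2$. * (A5) For all $n\in\mathbb N$, $S_1,\dots,S_n\in\mathcal T$, $1\le i\le3$ and $\phi\in\mathcal B_i$: $\|\mathcal L_{S_n}\cdots\mathcal L_{S_1}\phi\|_{\mathcal B_0}\le C_*\|\phi\|_{\mathcal B_0}$ and $\|\mathcal L_{S_n}\cdots\mathcal L_{S_1}\phi\|_{\mathcal B_i}\le C_*\vartheta^n\|\phi\|_{\mathcal B_i}+K\|\phi\|_{\mathcal B_{i-1}}$. * (A6) For all $n\ge\bar n$, $S_1,\dots,S_n\in\mathcal T$ and $1\le i\le3$, the operator norm of $\mathcal L_{S_n}\cdots\mathcal L_{S_1}$ restricted to $\{\phi\in\mathcal B_i:\int\phi=0\}$ (with the norm of $\mathcal B_i$) is strictly smaller than $\vartheta^n$. For $K_\star>0$ let $\mathbb W_{K_\star}=\{h\in\mathcal B_1:\ \|h\|_{\mathcal B_1}\le K_\star,\ h\ge0,\ \int h=1\}$. Then there is $K_0>0$ such that for every $K_\star\ge K_0$ and every $\nu\in[0,\nu_*]$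 the nonlinear transfer operator $\widetilde{\mathcal L}_\nu$ has a periodic orbit in $\mathcal B_1$ of period $\bar n$ (not necessarily the minimal period) through a point of $\mathbb W_{K_\star}$: there is $h\in\mathbb W_{K_\star}$ with $\widetilde{\mathcal L}_\nu^{\,\bar n}(h)=h$ and $\widetilde{\mathcal L}_\nu^{\,k}(h)\in\mathcal B_1$ for all $k\ge0$. -/

import Mathlib

open MeasureTheory
open scoped ContDiff

noncomputable section

/-- The torus `𝕋^d = ℝ^d / ℤ^d`. -/
abbrev Torus (d : ℕ) : Type := UnitAddTorus (Fin d)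

/-- The canonical projection `ℝ^d → 𝕋^d`. -/
def torusProj {d : ℕ} (x : Fin d → ℝ) : Torus d := fun i => (x i : UnitAddCircle)

theorem torusProj_add {d : ℕ} (x y : Fin d → ℝ) :
    torusProj (x + y) = torusProj x + torusProj y := by
  funext i
  simp [torusProj]

/-- Every point of the torus has a representative in the unit cube. -/
theorem exists_torusProj_eq {d : ℕ} (p : Torus d) :
    ∃ x ∈ Set.Icc (0 : Fin d → ℝ) 1, torusProj x = p := by
  have h : ∀ i, ∃ t ∈ Set.Ico (0 : ℝ) (0 + 1), (t : UnitAddCircle) = p i := fun i => by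
    have := AddCircle.coe_image_Ico_eq (1 : ℝ) 0
    have hp : p i ∈ ((↑) : ℝ → AddCircle (1 : ℝ)) '' Set.Ico 0 (0 + 1) := by
      rw [this]; trivial
    exact hp
  choose x hx hxp using h
  exact ⟨x, ⟨fun i => (hx i).1, fun i => by simpa using (hx i).2.le⟩, funext hxp⟩

theorem torusProj_surjective {d : ℕ} : Function.Surjective (torusProj (d := d)) := fun p => by
  obtain ⟨x, -, hx⟩ := exists_torusProj_eq p
  exact ⟨x, hx⟩

/-- Two points with the same projection have the same derivatives of all lifted functions. -/
theorem iteratedFDeriv_lift_congr {d : ℕ} (f : Torus d → ℝ) (k : ℕ) {x y : Fin d → ℝ}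
    (h : torusProj x = torusProj y) :
    iteratedFDeriv ℝ k (fun z => f (torusProj z)) x =
      iteratedFDeriv ℝ k (fun z => f (torusProj z)) y := by
  have h0 : torusProj (y - x) = 0 := by
    have := torusProj_add x (y - x)
    rw [add_sub_cancel, h] at this
    simpa using this
  have h1 : (fun z => f (torusProj (z + (y - x)))) = fun z => f (torusProj z) := by
    funext z
    rw [torusProj_add, h0, add_zero]
  have h2 := iteratedFDeriv_comp_add_right (𝕜 := ℝ) (f := fun z => f (torusProj z)) k (y - x) x
  rw [h1] at h2
  rw [h2]
  congr 1
  abel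

/-- `f : 𝕋^d → E` is of class `C^n`: its lift to `ℝ^d` is. -/
def TorusContDiff {d : ℕ} {E : Type*} [NormedAddCommGroup E] [NormedSpace ℝ E]
    (n : WithTop ℕ∞) (f : Torus d → E) : Prop :=
  ContDiff ℝ n fun x : Fin d → ℝ => f (torusProj x)

/-- The `C^m` norm `∑_{k ≤ m} sup |D^k f|` of a function on the torus. -/
def cNorm {d : ℕ} (m : ℕ) (f : Torus d → ℝ) : ℝ :=
  ∑ k ∈ Finset.range (m + 1), ⨆ x : Fin d → ℝ, ‖iteratedFDeriv ℝ k (fun z => f (torusProj z)) x‖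

/-- The vector space `C^n(𝕋^d, ℝ)`, as a space of functions. -/
def cSubmodule (d : ℕ) (n : WithTop ℕ∞) : Submodule ℝ (Torus d → ℝ) where
  carrier := {f | TorusContDiff n f}
  add_mem' hf hg := ContDiff.add hf hg
  zero_mem' := contDiff_const
  smul_mem' c _ hf := ContDiff.const_smul c hf

/-- The vector space `C^n(𝕋^d, ℝ)`; for finite `n` it is normed by `cNorm n`. -/
def CFun (d : ℕ) (n : WithTop ℕ∞) : Type := cSubmodule d n

namespace CFun

variable {d : ℕ} {n : WithTop ℕ∞}

instance : AddCommGroup (CFun d n) := inferInstanceAs (AddCommGroup (cSubmodule d n))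
instance : Module ℝ (CFun d n) := inferInstanceAs (Module ℝ (cSubmodule d n))
instance : CoeFun (CFun d n) fun _ => Torus d → ℝ := ⟨fun f => f.1⟩

/-- Build an element of `C^n(𝕋^d, ℝ)`. -/
def mk (f : Torus d → ℝ) (hf : TorusContDiff n f) : CFun d n := ⟨f, hf⟩

theorem contDiff (f : CFun d n) : ContDiff ℝ n fun x : Fin d → ℝ => f (torusProj x) := f.2

theorem ext {f g : CFun d n} (h : ∀ x, f x = g x) : f = g := Subtype.ext (funext h)

theorem add_apply (f g : CFun d n) (x : Torus d) : (f + g) x = f x + g x := rfl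

theorem smul_apply (c : ℝ) (f : CFun d n) (x : Torus d) : (c • f) x = c * f x := rfl

/-- The inclusion `C^n ⊆ C^m` for `m ≤ n`. -/
def ofLE {m : WithTop ℕ∞} (h : m ≤ n) (f : CFun d n) : CFun d m := mk f (f.contDiff.of_le h)

/-- A constant function. -/
def const (c : ℝ) : CFun d n := mk (fun _ => c) contDiff_const

/-- The pointwise product. -/
def mul (f g : CFun d n) : CFun d n := mk (fun x => f x * g x) (f.contDiff.mul g.contDiff)

/-- The partial derivative `∂_k f`; the derivative of the lift does not depend on the chosen
representative of the point, see `partialDerivFun_torusProj`. -/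
def partialDerivFun (k : Fin d) (f : Torus d → ℝ) (p : Torus d) : ℝ :=
  fderiv ℝ (fun z => f (torusProj z)) (Function.surjInv torusProj_surjective p) (Pi.single k 1)

theorem partialDerivFun_torusProj (k : Fin d) (f : Torus d → ℝ) (x : Fin d → ℝ) :
    partialDerivFun k f (torusProj x) =
      fderiv ℝ (fun z => f (torusProj z)) x (Pi.single k 1) := by
  have h := iteratedFDeriv_lift_congr f 1
    (Function.surjInv_eq torusProj_surjective (torusProj x))
  have h' := congrArg (fun A => A (fun _ => Pi.single k 1)) h
  simpa [partialDerivFun, iteratedFDeriv_one_apply] using h'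

/-- The partial derivative `∂_k f ∈ C^r(𝕋^d, ℝ)` of `f ∈ C^{r+1}(𝕋^d, ℝ)`. -/
def partialDeriv {r : ℕ} (k : Fin d) (f : CFun d (r + 1 : ℕ)) : CFun d r :=
  mk (partialDerivFun k f) (by
    have h : ContDiff ℝ r fun x => fderiv ℝ (fun z => f (torusProj z)) x (Pi.single k 1) :=
      (f.contDiff.fderiv_right (m := r) (by norm_cast)).clm_apply contDiff_const
    simpa only [TorusContDiff, partialDerivFun_torusProj] using h)

theorem bddAbove_iteratedFDeriv (f : CFun d n) {k : ℕ} (hk : (k : WithTop ℕ∞) ≤ n) :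
    BddAbove (Set.range fun x : Fin d → ℝ =>
      ‖iteratedFDeriv ℝ k (fun z => f (torusProj z)) x‖) := by
  have hc : Continuous fun x : Fin d → ℝ =>
      ‖iteratedFDeriv ℝ k (fun z => f (torusProj z)) x‖ :=
    (f.contDiff.continuous_iteratedFDeriv hk).norm
  obtain ⟨C, hC⟩ := (isCompact_Icc (a := (0 : Fin d → ℝ)) (b := 1)).bddAbove_image hc.continuousOn
  refine ⟨C, ?_⟩
  rintro _ ⟨x, rfl⟩
  obtain ⟨y, hy, hyx⟩ := exists_torusProj_eq (torusProj x)
  have := hC ⟨y, hy, rfl⟩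
  simpa only [iteratedFDeriv_lift_congr f k hyx] using this

variable {r : ℕ}

theorem norm_iteratedFDeriv_le_iSup (f : CFun d r) {k : ℕ} (hk : k ≤ r) (x : Fin d → ℝ) :
    ‖iteratedFDeriv ℝ k (fun z => f (torusProj z)) x‖ ≤
      ⨆ x : Fin d → ℝ, ‖iteratedFDeriv ℝ k (fun z => f (torusProj z)) x‖ :=
  le_ciSup (f.bddAbove_iteratedFDeriv (by exact_mod_cast hk)) x

theorem norm_iteratedFDeriv_le_cNorm (f : CFun d r) {k : ℕ} (hk : k ≤ r) (x : Fin d → ℝ) :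
    ‖iteratedFDeriv ℝ k (fun z => f (torusProj z)) x‖ ≤ cNorm r f :=
  (f.norm_iteratedFDeriv_le_iSup hk x).trans
    (Finset.single_le_sum
      (f := fun k => ⨆ x : Fin d → ℝ, ‖iteratedFDeriv ℝ k (fun z => f (torusProj z)) x‖)
      (fun _ _ => Real.iSup_nonneg fun _ => norm_nonneg _)
      (Finset.mem_range.2 (Nat.lt_succ_of_le hk)))

theorem abs_apply_le_cNorm (f : CFun d r) (p : Torus d) : |f p| ≤ cNorm r f := by
  obtain ⟨x, -, rfl⟩ := exists_torusProj_eq p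
  simpa using f.norm_iteratedFDeriv_le_cNorm (Nat.zero_le r) x

theorem cNorm_nonneg (f : Torus d → ℝ) : 0 ≤ cNorm r f :=
  Finset.sum_nonneg fun _ _ => Real.iSup_nonneg fun _ => norm_nonneg _

theorem cNorm_le_of_forall {f : Torus d → ℝ} {C : ℝ}
    (h : ∀ k ≤ r, ∀ x ∈ Set.Icc (0 : Fin d → ℝ) 1,
      ‖iteratedFDeriv ℝ k (fun z => f (torusProj z)) x‖ ≤ C) :
    cNorm r f ≤ (r + 1) * C := by
  have : ∀ k ∈ Finset.range (r + 1),
      (⨆ x : Fin d → ℝ, ‖iteratedFDeriv ℝ k (fun z => f (torusProj z)) x‖) ≤ C := by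
    intro k hk
    refine ciSup_le fun x => ?_
    obtain ⟨y, hy, hyx⟩ := exists_torusProj_eq (torusProj x)
    rw [← iteratedFDeriv_lift_congr f k hyx]
    exact h k (Nat.lt_succ_iff.1 (Finset.mem_range.1 hk)) y hy
  simpa [cNorm] using Finset.sum_le_card_nsmul _ _ _ this

theorem cNorm_add_le (f g : CFun d r) : cNorm r (f + g : CFun d r) ≤ cNorm r f + cNorm r g := by
  unfold cNorm
  rw [← Finset.sum_add_distrib]
  refine Finset.sum_le_sum fun k hk => ciSup_le fun x => ?_
  have hk' : k ≤ r := Nat.lt_succ_iff.1 (Finset.mem_range.1 hk)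
  have hk'' : (k : WithTop ℕ∞) ≤ r := by exact_mod_cast hk'
  have := iteratedFDeriv_add_apply (x := x) (f.contDiff.contDiffAt.of_le hk'')
    (g.contDiff.contDiffAt.of_le hk'')
  have h2 : (fun z => (f + g : CFun d r) (torusProj z)) =
    (fun z => f (torusProj z)) + fun z => g (torusProj z) := rfl
  rw [h2, this]
  exact (norm_add_le _ _).trans
    (add_le_add (f.norm_iteratedFDeriv_le_iSup hk' x) (g.norm_iteratedFDeriv_le_iSup hk' x))

theorem cNorm_smul (c : ℝ) (f : CFun d r) : cNorm r (c • f : CFun d r) = |c| * cNorm r f := by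
  unfold cNorm
  rw [Finset.mul_sum]
  refine Finset.sum_congr rfl fun k hk => ?_
  have hk'' : (k : WithTop ℕ∞) ≤ r := by
    exact_mod_cast Nat.lt_succ_iff.1 (Finset.mem_range.1 hk)
  rw [Real.mul_iSup_of_nonneg (abs_nonneg c)]
  refine iSup_congr fun x => ?_
  have h2 : (fun z => (c • f : CFun d r) (torusProj z)) = c • fun z => f (torusProj z) := rfl
  rw [h2, iteratedFDeriv_const_smul_apply (f.contDiff.contDiffAt.of_le hk''), norm_smul,
    Real.norm_eq_abs]

instance : Norm (CFun d r) := ⟨fun f => cNorm r f⟩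

theorem norm_def (f : CFun d r) : ‖f‖ = cNorm r f := rfl

theorem normCore : NormedSpace.Core ℝ (CFun d r) where
  norm_nonneg f := cNorm_nonneg _
  norm_smul c f := cNorm_smul c f
  norm_triangle f g := cNorm_add_le f g
  norm_eq_zero_iff f := by
    constructor
    · intro h
      refine ext fun p => ?_
      have := f.abs_apply_le_cNorm p
      rw [← norm_def, h] at this
      exact abs_nonpos_iff.1 this
    · rintro rfl
      have := cNorm_smul (0 : ℝ) (0 : CFun d r)
      simpa [norm_def] using this

instance : NormedAddCommGroup (CFun d r) := NormedAddCommGroup.ofCore normCore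
instance : NormedSpace ℝ (CFun d r) := NormedSpace.ofCore normCore

end CFun

/-- The Banach space `C^r(𝕋^d, ℝ)'` with its dual norm. -/
abbrev TorusDist (d r : ℕ) : Type := StrongDual ℝ (CFun d r)

/-- A map `𝕋^d → 𝕋^d` of class `C^n`: it has a `C^n` lift `ℝ^d → ℝ^d`. -/
structure TorusMap (d : ℕ) (n : WithTop ℕ∞) where
  toFun : Torus d → Torus d
  exists_lift : ∃ F : (Fin d → ℝ) → (Fin d → ℝ),
    ContDiff ℝ n F ∧ ∀ x, toFun (torusProj x) = torusProj (F x)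

namespace TorusMap

variable {d : ℕ} {n : WithTop ℕ∞}

/-- Composition `S ∘ R`. -/
def comp (S R : TorusMap d n) : TorusMap d n where
  toFun := S.toFun ∘ R.toFun
  exists_lift := by
    obtain ⟨F, hF, hFS⟩ := S.exists_lift
    obtain ⟨G, hG, hGR⟩ := R.exists_lift
    exact ⟨F ∘ G, hF.comp hG, fun x => by simp [hGR, hFS]⟩

/-- The composition `g ∘ S ∈ C^n` of `g ∈ C^n` with the `C^n` map `S`. -/
def pullback (S : TorusMap d n) (g : CFun d n) : CFun d n :=
  CFun.mk (fun p => g (S.toFun p)) (by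
    obtain ⟨F, hF, hFS⟩ := S.exists_lift
    simpa only [TorusContDiff, hFS, Function.comp_def] using g.contDiff.comp hF)

theorem exists_norm_pullback_le {r : ℕ} (S : TorusMap d r) :
    ∃ C : ℝ, ∀ g : CFun d r, ‖S.pullback g‖ ≤ C * ‖g‖ := by
  obtain ⟨F, hF, hFS⟩ := S.exists_lift
  have hb : ∀ k : ℕ, ∃ C : ℝ, k ≤ r → ∀ x ∈ Set.Icc (0 : Fin d → ℝ) 1,
      ‖iteratedFDeriv ℝ k F x‖ ≤ C := by
    intro k
    by_cases hk : k ≤ r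
    · have hc : Continuous fun x => ‖iteratedFDeriv ℝ k F x‖ :=
        (hF.continuous_iteratedFDeriv (by exact_mod_cast hk)).norm
      obtain ⟨C, hC⟩ :=
        (isCompact_Icc (a := (0 : Fin d → ℝ)) (b := 1)).bddAbove_image hc.continuousOn
      exact ⟨C, fun _ x hx => hC ⟨x, hx, rfl⟩⟩
    · exact ⟨0, fun h => absurd h hk⟩
  choose c hc using hb
  let D : ℝ := 1 + ∑ k ∈ Finset.range (r + 1), |c k|
  have hD1 : 1 ≤ D := le_add_of_nonneg_right (Finset.sum_nonneg fun _ _ => abs_nonneg _)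
  have hcD : ∀ k ≤ r, c k ≤ D := fun k hk => by
    have := Finset.single_le_sum (f := fun k => |c k|) (fun _ _ => abs_nonneg _)
      (Finset.mem_range.2 (Nat.lt_succ_of_le hk))
    exact (le_abs_self _).trans (this.trans (le_add_of_nonneg_left zero_le_one))
  refine ⟨(r + 1) * (r.factorial * D ^ r), fun g => ?_⟩
  rw [mul_assoc]
  refine CFun.cNorm_le_of_forall fun k hk x hx => ?_
  have hcomp : (fun z => S.pullback g (torusProj z)) = (fun z => g (torusProj z)) ∘ F := by
    funext z
    change g (S.toFun (torusProj z)) = _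
    rw [hFS]
    rfl
  rw [hcomp]
  refine (norm_iteratedFDeriv_comp_le g.contDiff hF (by exact_mod_cast hk) x (C := ‖g‖) (D := D)
    (fun i hi => g.norm_iteratedFDeriv_le_cNorm (hi.trans hk) _)
    (fun i hi1 hi => ((hc i (hi.trans hk) x hx).trans (hcD i (hi.trans hk))).trans
      (le_self_pow₀ hD1 (by omega)))).trans ?_
  have h1 : ((k.factorial : ℕ) : ℝ) ≤ r.factorial := by exact_mod_cast Nat.factorial_le hk
  have h2 : D ^ k ≤ D ^ r := pow_le_pow_right₀ hD1 hk
  have h3 : 0 ≤ ‖g‖ := norm_nonneg g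
  have h4 : 0 ≤ D ^ k := pow_nonneg (zero_le_one.trans hD1) k
  calc (k.factorial : ℝ) * ‖g‖ * D ^ k = (k.factorial * D ^ k) * ‖g‖ := by ring
    _ ≤ (r.factorial * D ^ r) * ‖g‖ := by gcongr

/-- The operator `g ↦ g ∘ S` on `C^r(𝕋^d, ℝ)`. -/
def koopman {r : ℕ} (S : TorusMap d r) : CFun d r →L[ℝ] CFun d r :=
  LinearMap.mkContinuousOfExistsBound
    { toFun := S.pullback
      map_add' := fun _ _ => rfl
      map_smul' := fun _ _ => rfl } S.exists_norm_pullback_le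

/-- The transfer operator `(L_S h)(g) = h(g ∘ S)` on `C^r(𝕋^d, ℝ)'`. -/
def transfer {r : ℕ} (S : TorusMap d r) (h : TorusDist d r) : TorusDist d r := h.comp S.koopman

theorem transfer_apply {r : ℕ} (S : TorusMap d r) (h : TorusDist d r) (g : CFun d r) :
    S.transfer h g = h (S.pullback g) := rfl

/-- For `l = [S₁, …, Sₙ]`, the composition `L_{Sₙ} ⋯ L_{S₁}`. -/
def transferList {r : ℕ} (l : List (TorusMap d r)) (h : TorusDist d r) : TorusDist d r :=
  l.foldl (fun φ S => S.transfer φ) h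

end TorusMap

/-- The data of a mean field coupled system: a smooth map `T` of the torus, a smooth observable
`α : 𝕋^d → ℝ` and a smooth `β : 𝕋^d → ℝ^d`. -/
structure CoupledSystem (d : ℕ) where
  T : TorusMap d ∞
  α : CFun d ∞
  β : Torus d → (Fin d → ℝ)
  smooth_β : TorusContDiff ∞ β

namespace CoupledSystem

variable {d r : ℕ}

/-- The coupled map `T_{ν,h}(x) = T(x) + ν β(x) h(α) mod 1`. -/
def map (sys : CoupledSystem d) (ν : ℝ) (h : TorusDist d r) : TorusMap d r where
  toFun p := sys.T.toFun p +
    torusProj ((ν * h (sys.α.ofLE (by exact_mod_cast le_top))) • sys.β p)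
  exists_lift := by
    obtain ⟨F, hF, hFT⟩ := sys.T.exists_lift
    refine ⟨fun x => F x +
      (ν * h (sys.α.ofLE (by exact_mod_cast le_top))) • sys.β (torusProj x), ?_, fun x => ?_⟩
    · exact (hF.add (sys.smooth_β.const_smul _)).of_le (by exact_mod_cast le_top)
    · rw [hFT, torusProj_add]

/-- The nonlinear transfer operator `h ↦ L_{T_{ν,h}} h`. -/
def nonlinearTransfer (sys : CoupledSystem d) (ν : ℝ) (h : TorusDist d r) : TorusDist d r :=
  (sys.map ν h).transfer h

end CoupledSystem

/-- `h` is (integration against) a Borel probability measure. -/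
def IsProbDist {d r : ℕ} (h : TorusDist d r) : Prop :=
  ∃ μ : Measure (Torus d), IsProbabilityMeasure μ ∧ ∀ φ : CFun d r, h φ = ∫ x, φ x ∂μ

section Spaces

variable {d r : ℕ} {B : Fin 4 → Type*} [∀ i, NormedAddCommGroup (B i)]
  [∀ i, NormedSpace ℝ (B i)]

/-- The embeddings `ι i : B i → C^r(𝕋^d, ℝ)'` exhibit the `B i` as a scale of spaces
`C^r(𝕋^d)' ⊃ B₀ ⊃ B₁ ⊃ B₂ ⊃ B₃ ⊃ C^r(𝕋^d)`, with norms increasing along the scale, such that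
`C^r(𝕋^d)` is dense in each `B i` and in each dual `(B i)'`. A function `φ` is identified with the
distribution `g ↦ ∫ φ g`, and it acts on `B i` by `b ↦ (ι i b) φ`. The chain of embeddings
`C^r(𝕋^d)' ⊃ B₃' ⊃ ⋯ ⊃ B₀' ⊃ C^r(𝕋^d)` (by restriction) follows from these properties. -/
structure IsBanachScale (ι : ∀ i, B i →L[ℝ] TorusDist d r) : Prop where
  injective : ∀ i, Function.Injective (ι i)
  incl : ∀ (i : Fin 3) (b : B i.succ), ∃ b' : B i.castSucc,
    ι i.castSucc b' = ι i.succ b ∧ ‖b'‖ ≤ ‖b‖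
  contains_functions : ∃ e : CFun d r →L[ℝ] B 3, ∀ φ g : CFun d r, ι 3 (e φ) g = ∫ x, φ x * g x
  dense : ∀ i, Dense {b : B i | ∃ φ : CFun d r, ∀ g : CFun d r, ι i b g = ∫ x, φ x * g x}
  dense_dual : ∀ i, DenseRange fun φ : CFun d r => ((ι i).flip φ : StrongDual ℝ (B i))

/-- The norm of `B i` as a function on distributions (used only for `f` in the image of `B i`). -/
def scaleNorm (ι : ∀ i, B i →L[ℝ] TorusDist d r) (i : Fin 4) (f : TorusDist d r) : ℝ :=
  ⨅ b : {b : B i // ι i b = f}, ‖b.1‖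

theorem scaleNorm_apply {ι : ∀ i, B i →L[ℝ] TorusDist d r} {i : Fin 4}
    (h : Function.Injective (ι i)) (b : B i) : scaleNorm ι i (ι i b) = ‖b‖ := by
  have : Nonempty {b' : B i // ι i b' = ι i b} := ⟨⟨b, rfl⟩⟩
  have h' : ∀ x : {b' : B i // ι i b' = ι i b}, ‖x.1‖ = ‖b‖ := fun x => by rw [h x.2]
  simp only [scaleNorm, h', ciInf_const]

/-- The set `W` of all `h ∈ B₁` with `‖h‖_{B₁} ≤ Kstar`, `h ≥ 0` and `∫ h = 1`. -/
def stateSet (ι : ∀ i, B i →L[ℝ] TorusDist d r) (Kstar : ℝ) : Set (TorusDist d r) :=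
  {h | h ∈ Set.range (ι 1) ∧ scaleNorm ι 1 h ≤ Kstar ∧
    (∀ φ : CFun d r, (∀ x, 0 ≤ φ x) → 0 ≤ h φ) ∧ h (CFun.const 1) = 1}

/-- The assumptions (A1)–(A6) on the set of maps `𝒯` and the spaces `B i`. The orders of
differentiability in (A3) are natural numbers: real (Hölder) orders may be rounded up. -/
structure TransferAssumptions (ι : ∀ i, B i →L[ℝ] TorusDist d r) (𝒯 : Set (TorusMap d r))
    (K Cst θ : ℝ) (cbar chat nbar : ℕ) : Prop where
  one_le_K : 1 ≤ K
  one_le_Cst : 1 ≤ Cst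
  θ_mem : θ ∈ Set.Ioo (0 : ℝ) 1
  cbar_pos : 0 < cbar
  chat_pos : 0 < chat
  nbar_pos : 0 < nbar
  /-- (A1): `L_S` restricts to a bounded operator on `B i`. -/
  bounded : ∀ S ∈ 𝒯, ∀ i, ∃ A : B i →L[ℝ] B i, ∀ b, ι i (A b) = S.transfer (ι i b)
  /-- (A2): the distributional derivative `∂_k` is a bounded operator from `B (i+1)` to `B i`. -/
  derivative : ∀ (k : Fin d) (i : Fin 3), ∃ A : B i.succ →L[ℝ] B i.castSucc,
    ∀ (b : B i.succ) (φ : CFun d (r + 1 : ℕ)),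
      ι i.castSucc (A b) (φ.ofLE (by exact_mod_cast Nat.le_succ r)) =
        -ι i.succ b (φ.partialDeriv k)
  /-- (A3), first part: `‖a h‖_{B i} ≤ Cst ‖a‖_{C^{cbar i + chat}} ‖h‖_{B i}`, for smooth `a`. -/
  multiplication : ∀ (i : Fin 4) (a : CFun d ∞) (b : B i), ∃ b' : B i,
    (∀ φ : CFun d r, ι i b' φ = ι i b ((a.ofLE (by exact_mod_cast le_top)).mul φ)) ∧
      ‖b'‖ ≤ Cst * cNorm (cbar * (i : ℕ) + chat) a * ‖b‖
  /-- (A3), second part: `|∫ h| ≤ Cst ‖h‖_{B 0}`. -/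
  integral_le : ∀ b : B 0, |ι 0 b (CFun.const 1)| ≤ Cst * ‖b‖
  /-- (A4): the unit ball of `B (i+1)` is relatively compact in `B i`. -/
  compact : ∀ i : Fin 3, IsCompact
    (closure {b' : B i.castSucc | ∃ b : B i.succ, ‖b‖ ≤ 1 ∧ ι i.castSucc b' = ι i.succ b})
  /-- (A5), first part. -/
  weak_bound : ∀ l : List (TorusMap d r), (∀ S ∈ l, S ∈ 𝒯) → ∀ i : Fin 3,
    ∀ φ ∈ Set.range (ι i.succ),
      scaleNorm ι 0 (TorusMap.transferList l φ) ≤ Cst * scaleNorm ι 0 φ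
  /-- (A5), second part: the uniform Lasota–Yorke inequality. -/
  lasota_yorke : ∀ l : List (TorusMap d r), (∀ S ∈ l, S ∈ 𝒯) → ∀ i : Fin 3,
    ∀ φ ∈ Set.range (ι i.succ),
      scaleNorm ι i.succ (TorusMap.transferList l φ) ≤
        Cst * θ ^ l.length * scaleNorm ι i.succ φ + K * scaleNorm ι i.castSucc φ
  /-- (A6): the operator norm of `L_{Sₙ} ⋯ L_{S₁}` on `{h ∈ B i | ∫ h = 0}` is smaller than `θ ^ n`
  for `n ≥ nbar`. -/
  contraction : ∀ l : List (TorusMap d r), (∀ S ∈ l, S ∈ 𝒯) → nbar ≤ l.length → ∀ i : Fin 3,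
    ∃ c < θ ^ l.length, ∀ φ ∈ Set.range (ι i.succ), φ (CFun.const 1) = 0 →
      scaleNorm ι i.succ (TorusMap.transferList l φ) ≤ c * scaleNorm ι i.succ φ

end Spaces

end

/-!
The coupled map `T_{ν,h}` depends on `h` only through the number `h(α)`. This makes a
one-dimensional argument possible, and yields a periodic orbit that is in fact a fixed point of the
nonlinear operator.

For a single map `S ∈ 𝒯`, the contraction of zero-mean elements of `B₁` makes `L_S^n 1` a Cauchy
sequence in `B₁`. Its limit `h_S` is a positive `L_S`-invariant distribution of mass one, the
Lasota–Yorke inequality bounds `‖h_S‖_{B₁}` independently of `S`, and the convergence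
`∫ g ∘ S^n dx → h_S(g)` is uniform in `S` (`TransferAssumptions.exists_invariant`).

For a point `x` of the torus let `S_x = T + ν α(x) β`, the coupled map of the Dirac mass at `x`.
Then `F(x) = h_{S_x}(α)` is a uniform limit of the continuous functions `x ↦ ∫ α ∘ S_x^n`, hence
continuous, and its values lie between the minimum and the maximum of `α`. As the torus is connected,
`F(x) = α(x)` for some `x`. For `h = h_{S_x}` this says `h(α) = α(x)`, so that `T_{ν,h} = S_x` and
`L_{T_{ν,h}} h = L_{S_x} h = h`.
-/

open Filter Topology

/-! ### Continuity on the torus, Dirac masses and positive distributions -/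

theorem continuous_torusProj {d : ℕ} : Continuous (torusProj (d := d)) :=
  continuous_pi fun i => (AddCircle.continuous_mk' 1).comp (continuous_apply i)

theorem isQuotientMap_torusProj {d : ℕ} : IsQuotientMap (torusProj (d := d)) :=
  (IsOpenQuotientMap.piMap fun _ : Fin d =>
    (QuotientAddGroup.isOpenQuotientMap_mk :
      IsOpenQuotientMap ((↑) : ℝ → UnitAddCircle))).isQuotientMap

theorem TorusContDiff.continuous {d : ℕ} {E : Type*} [NormedAddCommGroup E] [NormedSpace ℝ E]
    {n : WithTop ℕ∞} {f : Torus d → E} (hf : TorusContDiff n f) : Continuous f :=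
  isQuotientMap_torusProj.continuous_iff.2 (ContDiff.continuous hf)

theorem CFun.continuous {d : ℕ} {n : WithTop ℕ∞} (f : CFun d n) : Continuous fun p => f p :=
  TorusContDiff.continuous f.2

theorem TorusMap.continuous {d : ℕ} {n : WithTop ℕ∞} (S : TorusMap d n) : Continuous S.toFun := by
  obtain ⟨F, hF, hFS⟩ := S.exists_lift
  refine isQuotientMap_torusProj.continuous_iff.2 ?_
  have h : S.toFun ∘ torusProj = torusProj ∘ F := funext hFS
  rw [h]
  exact continuous_torusProj.comp hF.continuous

/-- The Dirac mass `φ ↦ φ p` as a distribution. -/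
noncomputable def diracDist {d r : ℕ} (p : Torus d) : TorusDist d r :=
  LinearMap.mkContinuous
    { toFun := fun φ : CFun d r => φ p
      map_add' := fun _ _ => rfl
      map_smul' := fun _ _ => rfl } 1
    fun φ => by
      rw [one_mul]
      exact φ.abs_apply_le_cNorm p

theorem diracDist_apply {d r : ℕ} (p : Torus d) (φ : CFun d r) : diracDist p φ = φ p := rfl

theorem isProbabilityMeasure_volume_torus (d : ℕ) :
    IsProbabilityMeasure (volume : Measure (Torus d)) :=
  ⟨by rw [← Set.pi_univ Set.univ, volume_pi_pi]; simp⟩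

theorem continuous_integral_torus {d : ℕ} {f : Torus d × Torus d → ℝ} (hf : Continuous f) :
    Continuous fun x => ∫ p, f (x, p) := by
  have := isProbabilityMeasure_volume_torus d
  have h := continuous_parametric_integral_of_continuous (μ := (volume : Measure (Torus d)))
    (f := fun x p => f (x, p)) hf isCompact_univ
  simpa only [Measure.restrict_univ] using h

/-- A positive distribution of mass one does not exceed the upper bounds of a function. -/
theorem apply_le_of_nonneg_of_mass_one {d r : ℕ} {h : TorusDist d r}
    (hpos : ∀ φ : CFun d r, (∀ p, 0 ≤ φ p) → 0 ≤ h φ) (hone : h (CFun.const 1) = 1)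
    {f : CFun d r} {c : ℝ} (hc : ∀ p, f p ≤ c) : h f ≤ c := by
  have h1 := hpos (c • CFun.const 1 + (-1 : ℝ) • f) fun p => by
    rw [CFun.add_apply, CFun.smul_apply, CFun.smul_apply]
    change 0 ≤ c * 1 + -1 * f p
    linarith [hc p]
  rw [map_add, map_smul, map_smul, hone, smul_eq_mul, smul_eq_mul] at h1
  linarith

/-- A positive distribution of mass one is at least the lower bounds of a function. -/
theorem le_apply_of_nonneg_of_mass_one {d r : ℕ} {h : TorusDist d r}
    (hpos : ∀ φ : CFun d r, (∀ p, 0 ≤ φ p) → 0 ≤ h φ) (hone : h (CFun.const 1) = 1)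
    {f : CFun d r} {c : ℝ} (hc : ∀ p, c ≤ f p) : c ≤ h f := by
  have h1 : h ((-1 : ℝ) • f) ≤ -c := apply_le_of_nonneg_of_mass_one hpos hone fun p => by
    rw [CFun.smul_apply]
    linarith [hc p]
  rw [map_smul, smul_eq_mul] at h1
  linarith

theorem isProbDist_diracDist {d r : ℕ} (p : Torus d) : IsProbDist (diracDist p : TorusDist d r) :=
  ⟨Measure.dirac p, inferInstance, fun φ => by
    rw [integral_dirac]
    rfl⟩

/-! ### Iterates of a transfer operator -/

namespace TorusMap

variable {d r : ℕ}

theorem transferList_replicate (S : TorusMap d r) (n : ℕ) (h : TorusDist d r) :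
    transferList (List.replicate n S) h = S.transfer^[n] h := by
  induction n generalizing h with
  | zero => rfl
  | succ n ih => exact ih (S.transfer h)

theorem transfer_iterate_apply (S : TorusMap d r) (n : ℕ) (h : TorusDist d r) (g : CFun d r) :
    (S.transfer^[n] h) g = h (S.pullback^[n] g) := by
  induction n generalizing h with
  | zero => rfl
  | succ n ih =>
    rw [Function.iterate_succ_apply, ih, transfer_apply, Function.iterate_succ_apply']

theorem pullback_iterate_apply (S : TorusMap d r) (n : ℕ) (g : CFun d r) (p : Torus d) :
    (S.pullback^[n] g) p = g (S.toFun^[n] p) := by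
  induction n generalizing p with
  | zero => rfl
  | succ n ih =>
    rw [Function.iterate_succ_apply', Function.iterate_succ_apply]
    exact ih (S.toFun p)

end TorusMap

/-! ### Invariant distributions of a single map -/

section Invariant

variable {d r : ℕ} {B : Fin 4 → Type*} [∀ i, NormedAddCommGroup (B i)]
  [∀ i, NormedSpace ℝ (B i)] {ι : ∀ i, B i →L[ℝ] TorusDist d r}

/-- Lebesgue measure belongs to `B₁`. -/
theorem IsBanachScale.exists_volume (hι : IsBanachScale ι) :
    ∃ u : B 1, ∀ g : CFun d r, ι 1 u g = ∫ x, g x := by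
  obtain ⟨e, he⟩ := hι.contains_functions
  obtain ⟨u₂, h₂, -⟩ := hι.incl 2 (e (CFun.const 1))
  obtain ⟨u₁, h₁, -⟩ := hι.incl 1 u₂
  refine ⟨u₁, fun g => ?_⟩
  have h : ι 1 u₁ = ι 3 (e (CFun.const 1)) := h₁.trans h₂
  rw [h, he]
  exact integral_congr_ae (Eventually.of_forall fun x => one_mul _)

/-- Each map `S ∈ 𝒯` has an invariant distribution in `B₁`, approached by the images of Lebesgue
measure under the iterates of `S`; the bounds on its norm and on the rate of convergence do not
depend on `S`. -/
theorem TransferAssumptions.exists_invariant [CompleteSpace (B 1)] (hι : IsBanachScale ι)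
    {𝒯 : Set (TorusMap d r)} {K Cst θ : ℝ} {cbar chat nbar : ℕ}
    (hA : TransferAssumptions ι 𝒯 K Cst θ cbar chat nbar) :
    ∃ K₀ : ℝ, 0 < K₀ ∧ ∃ M : ℝ, ∀ S ∈ 𝒯, ∃ b : B 1,
      S.transfer (ι 1 b) = ι 1 b ∧ ‖b‖ ≤ K₀ ∧
        ∀ n ≥ nbar, ∀ g : CFun d r,
          |ι 1 b g - ∫ p, g (S.toFun^[n] p)| ≤ ‖g‖ * M * θ ^ n := by
  obtain ⟨u, hu⟩ := hι.exists_volume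
  obtain ⟨hθ0, hθ1⟩ := hA.θ_mem
  have hC := hA.one_le_Cst
  have hK := hA.one_le_K
  have hs0 : 0 ≤ scaleNorm ι 0 (ι 1 u) := Real.iInf_nonneg fun _ => norm_nonneg _
  -- The Lasota–Yorke bound for the orbit of Lebesgue measure; `+ 1` makes it positive.
  set K₀ : ℝ := Cst * ‖u‖ + K * scaleNorm ι 0 (ι 1 u) + 1 with hK₀
  refine ⟨K₀, by positivity, ‖ι 1‖ * (K₀ + ‖u‖), fun S hS => ?_⟩
  obtain ⟨A, hAS⟩ := hA.bounded S hS 1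
  have hAn : ∀ n b, ι 1 (A^[n] b) = S.transfer^[n] (ι 1 b) := fun n => by
    induction n with
    | zero => exact fun _ => rfl
    | succ n ih =>
      intro b
      rw [Function.iterate_succ_apply, ih, hAS, Function.iterate_succ_apply]
  have hl : ∀ n, ∀ R ∈ List.replicate n S, R ∈ 𝒯 := fun n R hR => by
    rwa [List.eq_of_mem_replicate hR]
  have hbound : ∀ n, ‖A^[n] u‖ ≤ K₀ := fun n => by
    have h := hA.lasota_yorke _ (hl n) 0 (ι 1 u) ⟨u, rfl⟩
    rw [TorusMap.transferList_replicate, ← hAn, List.length_replicate] at h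
    have h' : ‖A^[n] u‖ ≤ Cst * θ ^ n * ‖u‖ + K * scaleNorm ι 0 (ι 1 u) := by
      rw [← scaleNorm_apply (hι.injective 1) (A^[n] u), ← scaleNorm_apply (hι.injective 1) u]
      exact h
    have h1 : Cst * θ ^ n * ‖u‖ ≤ Cst * ‖u‖ := by
      gcongr
      exact mul_le_of_le_one_right (by linarith) (pow_le_one₀ hθ0.le hθ1.le)
    linarith
  have hcontr : ∀ n ≥ nbar, ∀ b : B 1, ι 1 b (CFun.const 1) = 0 →
      ‖A^[n] b‖ ≤ θ ^ n * ‖b‖ := fun n hn b hb => by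
    obtain ⟨c, hc, h⟩ := hA.contraction _ (hl n) (by simpa using hn) 0
    have h := h (ι 1 b) ⟨b, rfl⟩ hb
    rw [TorusMap.transferList_replicate, ← hAn] at h
    rw [List.length_replicate] at hc
    have h' : ‖A^[n] b‖ ≤ c * ‖b‖ := by
      rw [← scaleNorm_apply (hι.injective 1) (A^[n] b), ← scaleNorm_apply (hι.injective 1) b]
      exact h
    exact h'.trans (by gcongr)
  have hsub : ∀ n (b b' : B 1), A^[n] (b - b') = A^[n] b - A^[n] b' := fun n b b' =>
    iterate_map_sub A n b b'
  have hmass : ∀ b : B 1, ι 1 (A b) (CFun.const 1) = ι 1 b (CFun.const 1) := fun b => by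
    rw [hAS]
    rfl
  -- Successive differences `A^n (A u - u)` decay geometrically, as `A u - u` has zero mean.
  have hcauchy : CauchySeq fun n => A^[n + nbar] u := by
    refine cauchySeq_of_le_geometric θ (θ ^ nbar * ‖A u - u‖) hθ1 fun n => ?_
    have h := hcontr (n + nbar) (Nat.le_add_left _ _) (A u - u) (by simp [hmass])
    rw [hsub, ← Function.iterate_succ_apply] at h
    rw [dist_comm, dist_eq_norm, show n + 1 + nbar = (n + nbar).succ by omega]
    exact h.trans (by rw [pow_add]; linarith)
  obtain ⟨b, hb⟩ := cauchySeq_tendsto_of_complete hcauchy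
  have hfix : A b = b := by
    have h1 : Tendsto (fun n => A^[n + 1 + nbar] u) atTop (𝓝 b) :=
      hb.comp (tendsto_add_atTop_nat 1)
    have h2 : Tendsto (fun n => A (A^[n + nbar] u)) atTop (𝓝 (A b)) :=
      (A.continuous.tendsto b).comp hb
    refine tendsto_nhds_unique h2 (h1.congr fun n => ?_)
    rw [show n + 1 + nbar = (n + nbar).succ by omega, Function.iterate_succ_apply']
  have hbK : ‖b‖ ≤ K₀ := le_of_tendsto hb.norm (Eventually.of_forall fun n => hbound _)
  have hmn : ∀ n, ι 1 (A^[n] u) (CFun.const 1) = ι 1 u (CFun.const 1) := fun n => by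
    induction n with
    | zero => rfl
    | succ n ih => rw [Function.iterate_succ_apply', hmass, ih]
  have hmb : ι 1 b (CFun.const 1) = ι 1 u (CFun.const 1) := by
    have hc : Continuous fun b : B 1 => ι 1 b (CFun.const 1) :=
      ((ι 1).flip (CFun.const 1)).continuous
    have h := (hc.tendsto b).comp hb
    exact tendsto_nhds_unique h (tendsto_const_nhds.congr fun n => (hmn _).symm)
  refine ⟨b, by rw [← hAS, hfix], hbK, fun n hn g => ?_⟩
  have h1 : ∫ p, g (S.toFun^[n] p) = ι 1 (A^[n] u) g := by
    rw [hAn, TorusMap.transfer_iterate_apply, hu]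
    simp only [TorusMap.pullback_iterate_apply]
  have h2 : A^[n] b = b := Function.iterate_fixed hfix n
  have h3 : ‖b - A^[n] u‖ ≤ θ ^ n * (K₀ + ‖u‖) := by
    have h := hcontr n hn (b - u) (by simp [hmb])
    rw [hsub, h2] at h
    refine h.trans ?_
    gcongr
    exact (norm_sub_le b u).trans (by gcongr)
  calc |ι 1 b g - ∫ p, g (S.toFun^[n] p)| = ‖ι 1 (b - A^[n] u) g‖ := by
        rw [h1, map_sub]
        rfl
    _ ≤ ‖ι 1‖ * ‖b - A^[n] u‖ * ‖g‖ := (ι 1).le_opNorm₂ _ _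
    _ ≤ ‖ι 1‖ * (θ ^ n * (K₀ + ‖u‖)) * ‖g‖ := by gcongr
    _ = ‖g‖ * (‖ι 1‖ * (K₀ + ‖u‖)) * θ ^ n := by ring

end Invariant

/-! ### The coupled maps of Dirac masses -/

namespace CoupledSystem

variable {d r : ℕ}

/-- The coupled map depends on `h` only through the number `h(α)`. -/
theorem map_congr (sys : CoupledSystem d) (ν : ℝ) {h h' : TorusDist d r}
    (hα : h (sys.α.ofLE (by exact_mod_cast le_top)) = h' (sys.α.ofLE (by exact_mod_cast le_top))) :
    sys.map ν h = sys.map ν h' := by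
  simp only [map, hα]

/-- The iterates of the coupled map of the Dirac mass at `x`, applied to `p`, are continuous in
`(x, p)`. -/
theorem continuous_iterate_map_diracDist (sys : CoupledSystem d) (ν : ℝ) (n : ℕ) :
    Continuous fun q : Torus d × Torus d =>
      (sys.map ν (diracDist q.1 : TorusDist d r)).toFun^[n] q.2 := by
  induction n with
  | zero => exact continuous_snd
  | succ n ih =>
    simp only [Function.iterate_succ_apply']
    have hmap : Continuous fun q : Torus d × Torus d =>
        (sys.map ν (diracDist q.1 : TorusDist d r)).toFun q.2 := by
      have hα : Continuous fun q : Torus d × Torus d => sys.α q.1 :=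
        sys.α.continuous.comp continuous_fst
      have hβ : Continuous fun q : Torus d × Torus d => sys.β q.2 :=
        sys.smooth_β.continuous.comp continuous_snd
      exact (sys.T.continuous.comp continuous_snd).add
        (continuous_torusProj.comp ((continuous_const.mul hα).smul hβ))
    exact hmap.comp (continuous_fst.prodMk ih)

end CoupledSystem

theorem mainTheorem7 {d r : ℕ} (hr : 12 < r) (sys : CoupledSystem d)
    {B : Fin 4 → Type*} [∀ i, NormedAddCommGroup (B i)] [∀ i, NormedSpace ℝ (B i)]
    [∀ i, CompleteSpace (B i)]
    (ι : ∀ i, B i →L[ℝ] TorusDist d r) (hι : IsBanachScale ι)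
    (𝒯 : Set (TorusMap d r))
    (h𝒯surj : ∀ S ∈ 𝒯, Function.Surjective S.toFun)
    (h𝒯comp : ∀ S ∈ 𝒯, ∀ R ∈ 𝒯, S.comp R ∈ 𝒯)
    (νstar : ℝ) (hνstar : 0 < νstar)
    (hmap : ∀ ν ∈ Set.Icc 0 νstar, ∀ h : TorusDist d r, IsProbDist h → sys.map ν h ∈ 𝒯)
    (K Cst θ : ℝ) (cbar chat nbar : ℕ)
    (hA : TransferAssumptions ι 𝒯 K Cst θ cbar chat nbar) :
    ∃ K₀ : ℝ, 0 < K₀ ∧ ∀ Kstar ≥ K₀, ∀ ν ∈ Set.Icc 0 νstar,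
      ∃ h ∈ stateSet ι Kstar,
        Function.IsPeriodicPt (sys.nonlinearTransfer ν) nbar h ∧
        ∀ k : ℕ, (sys.nonlinearTransfer ν)^[k] h ∈ Set.range (ι 1) := by
  obtain ⟨K₀, hK₀, M, hinv⟩ := hA.exists_invariant hι
  refine ⟨K₀, hK₀, fun Kstar hKstar ν hν => ?_⟩
  have := isProbabilityMeasure_volume_torus d
  have hθ : Tendsto (fun n => θ ^ n) atTop (𝓝 0) :=
    tendsto_pow_atTop_nhds_zero_of_lt_one hA.θ_mem.1.le hA.θ_mem.2
  let S : Torus d → TorusMap d r := fun x => sys.map ν (diracDist x : TorusDist d r)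
  choose b hbfix hbK hb using fun x => hinv (S x) (hmap ν hν _ (isProbDist_diracDist x))
  have hlim : ∀ x g, Tendsto (fun n => ∫ p, g ((S x).toFun^[n] p)) atTop (𝓝 (ι 1 (b x) g)) := by
    intro x g
    have h0 : Tendsto (fun n => ‖g‖ * M * θ ^ n) atTop (𝓝 0) := by
      simpa using hθ.const_mul (‖g‖ * M)
    refine tendsto_iff_dist_tendsto_zero.2 (squeeze_zero' (Eventually.of_forall fun _ => dist_nonneg)
      ((eventually_ge_atTop nbar).mono fun n hn => ?_) h0)
    rw [dist_comm]
    exact hb x n hn g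
  have hpos : ∀ x, ∀ φ : CFun d r, (∀ p, 0 ≤ φ p) → 0 ≤ ι 1 (b x) φ := fun x φ hφ =>
    ge_of_tendsto' (hlim x φ) fun n => integral_nonneg fun p => hφ _
  have hone : ∀ x, ι 1 (b x) (CFun.const 1) = 1 := fun x => by
    refine tendsto_nhds_unique (hlim x (CFun.const 1)) (tendsto_const_nhds.congr fun n => ?_)
    change (1 : ℝ) = ∫ _ : Torus d, (1 : ℝ)
    simp
  set α : CFun d r := sys.α.ofLE (by exact_mod_cast le_top) with hα
  have hcont : Continuous fun x => ι 1 (b x) α := by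
    have hunif : TendstoUniformly (fun (n : ℕ) x => ∫ p, α ((S x).toFun^[n] p))
        (fun x => ι 1 (b x) α) atTop := by
      rw [Metric.tendstoUniformly_iff]
      intro ε hε
      have h0 : Tendsto (fun n => ‖α‖ * M * θ ^ n) atTop (𝓝 0) := by
        simpa using hθ.const_mul (‖α‖ * M)
      filter_upwards [h0.eventually_lt_const hε, eventually_ge_atTop nbar] with n hn hn' x
      exact (hb x n hn' α).trans_lt hn
    refine hunif.continuous (Eventually.of_forall fun n => ?_).frequently
    have hc : Continuous fun q : Torus d × Torus d => α ((S q.1).toFun^[n] q.2) :=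
      α.continuous.comp (sys.continuous_iterate_map_diracDist ν n)
    exact continuous_integral_torus hc
  have hαc : Continuous fun p : Torus d => α p := α.continuous
  obtain ⟨y, -, hy⟩ := (isCompact_univ (X := Torus d)).exists_isMinOn Set.univ_nonempty
    hαc.continuousOn
  obtain ⟨z, -, hz⟩ := (isCompact_univ (X := Torus d)).exists_isMaxOn Set.univ_nonempty
    hαc.continuousOn
  have hy' : α y ≤ ι 1 (b y) α :=
    le_apply_of_nonneg_of_mass_one (hpos y) (hone y) fun p => hy (Set.mem_univ p)
  have hz' : ι 1 (b z) α ≤ α z :=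
    apply_le_of_nonneg_of_mass_one (hpos z) (hone z) fun p => hz (Set.mem_univ p)
  obtain ⟨x, hx⟩ := intermediate_value_univ₂ hαc hcont hy' hz'
  -- `ι 1 (b x)` takes on `α` the value `α x` that defines `S x`.
  have hfix : Function.IsFixedPt (sys.nonlinearTransfer ν) (ι 1 (b x)) := by
    have hS : sys.map ν (ι 1 (b x)) = S x := sys.map_congr ν hx.symm
    change (sys.map ν (ι 1 (b x))).transfer (ι 1 (b x)) = ι 1 (b x)
    rw [hS, hbfix]
  refine ⟨ι 1 (b x), ⟨⟨b x, rfl⟩, ?_, hpos x, hone x⟩, hfix.iterate nbar, fun k => ?_⟩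
  · rw [scaleNorm_apply (hι.injective 1)]
    exact (hbK x).trans hKstar
  · rw [(hfix.iterate k).eq]
    exact ⟨b x, rfl⟩
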